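/- Let $G$ be a locally compact second countable (Hausdorff) topological group, $H$ a closed subgroup, $\mu_G,\mu_H$ left Haar measures on $G$ and $H$, and $\Delta_G,\Delta_H$ the modular functions, normalised by $\mu(Eg)=\Delta(g)\mu(E)$. Fix a continuous function $\theta:G\to[0,\infty)$ such that $\int_H\theta(gh)\,d\mu_H(h)=1$ for all $g\in G$ and $CH\cap\operatorname{supp}\theta$ is compact for every compact $C\subset G$. Let $\sigma$ be a strongly continuous unitary representation of $H$ on a complex separable Hilbert space $\mathcal K$ and $\pi$ a strongly continuous unitary representation of $G$ on a complex separable Hilbert space $\mathcal H$. Let $\mathcal F^\sigma$ be the space of ($\mu_G$-a.e. classes of) $\mu_G$-measurable functions $F:G\to\mathcal K$ such that, for every $h\in H$, $F(gh)=\sqrt{\Delta_H(h)/\Delta_G(h)}\,\sigma(h^{-1})F(g)$ for $\mu_G$-almost all $g\in G$, and $\int_G\|F(g)\|^2\theta(g)\,d\mu_G(g)<\infty$, with the norm of $L^2(G,\theta\mu_G,\mathcal K)$. The induced representation $\operatorname{Ind}_H^G\sigma$ acts on $\mathcal F^\sigma$ by $(\operatorname{Ind}_g F)(g')=F(g^{-1}g')$.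 Let $\mathcal G_\pi\subset\mathcal H$ be the Gårding domain of $\pi$, i.e. the linear span of the vectors $\pi(f)u=\int_G f(g)\pi(g)u\,d\mu_G(g)$ with $f\in C_c(G)$, $u\in\mathcal H$. An admissible map for $\pi$ modulo $(H,\sigma)$ is a linear map $A:\mathcal G_\pi\to\mathcal K$ such that $\sigma(h)Av=\sqrt{\Delta_H(h)/\Delta_G(h)}\,A\pi(h)v$ for all $h\in H$, $v\in\mathcal G_\pi$; for all $v\in\mathcal G_\pi$ the map $g\mapsto A\pi(g^{-1})v$ is $\mu_G$-measurable; and there is a constant $\beta>0$ with $\int_G\|A\pi(g^{-1})v\|^2\theta(g)\,d\mu_G(g)\le\beta\|v\|^2$ for all $v\in\mathcal G_\pi$. Then the following conditions are equivalent: (i) $\pi$ is (unitarily) equivalent to a subrepresentation of $\operatorname{Ind}_H^G\sigma$, i.e. to its restriction to some closed invariant subspace; (ii) there is an admissible map $A$ for $\pi$ modulo $(H,\sigma)$ such that $\int_G\|A\pi(g^{-1})v\|^2\theta(g)\,d\mu_G(g)=\|v\|^2$ for all $v\in\mathcal G_\pi$; (iii) there are an admissible map $A$ for $\pi$ modulo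 $(H,\sigma)$ and constants $0<\alpha\le\beta$ such that $\alpha\|v\|^2\le\int_G\|A\pi(g^{-1})v\|^2\theta(g)\,d\mu_G(g)\le\beta\|v\|^2$ for all $v\in\mathcal G_\pi$. If these conditions hold, $\pi$ is called square-integrable modulo $(H,\sigma)$. -/

import Mathlib

open MeasureTheory MeasureTheory.Measure
open scoped ENNReal NNReal CompactlySupported Pointwise

set_option linter.unusedSectionVars false

namespace SqInt

section Haar
variable {G : Type*} [Group G] [TopologicalSpace G] [IsTopologicalGroup G]
  [LocallyCompactSpace G] [SecondCountableTopology G] [T2Space G]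

instance locallyCompactSpace_of_isClosed {G : Type*} [Group G] [TopologicalSpace G]
    [LocallyCompactSpace G] (H : Subgroup G) [hH : IsClosed (H : Set G)] :
    LocallyCompactSpace H := hH.isClosedEmbedding_subtypeVal.locallyCompactSpace

/-- The modular function `Δ`, normalised by `μ (E g) = Δ(g) μ(E)` for a left Haar measure `μ`
(see `measure_mul_right`). Mathlib's `modularCharacter` is the inverse convention. -/
noncomputable def modularFn {G : Type*} [Group G] [TopologicalSpace G] [IsTopologicalGroup G]
    [LocallyCompactSpace G] (g : G) : ℝ≥0 := modularCharacter g⁻¹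

variable [MeasurableSpace G] [BorelSpace G] (μ : Measure G) [IsHaarMeasure μ]

theorem modularFn_pos (g : G) : 0 < modularFn g := modularCharacterFun_pos _

theorem modularFn_mul (g g' : G) : modularFn (g * g') = modularFn g * modularFn g' := by
  simp [modularFn, mul_comm]

theorem modularFn_inv (g : G) : modularFn g⁻¹ = (modularFn g)⁻¹ := by
  refine eq_inv_of_mul_eq_one_left ?_
  rw [← modularFn_mul]; simp [modularFn]

theorem map_mul_right (g : G) : μ.map (· * g) = modularFn g⁻¹ • μ := by
  rw [map_right_mul_eq_modularCharacterFun_smul]; simp [modularFn, modularCharacter]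

theorem lintegral_mul_right (f : G → ℝ≥0∞) (hf : AEMeasurable f μ) (h : G) :
    ∫⁻ g, f (g * h) ∂μ = modularFn h⁻¹ * ∫⁻ g, f g ∂μ := by
  have hm : AEMeasurable f (μ.map (· * h)) := by
    rw [map_mul_right]; exact hf.mono_ac (smul_absolutelyContinuous)
  rw [← lintegral_map' hm (measurable_mul_const h).aemeasurable, map_mul_right]
  rw [lintegral_smul_measure, ENNReal.smul_def, smul_eq_mul]

theorem measure_mul_right (E : Set G) (hE : MeasurableSet E) (g : G) :
    μ ((· * g) '' E) = modularFn g * μ E := by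
  have : ((· * g) '' E) = (· * g⁻¹) ⁻¹' E := by
    ext x; simp 
  rw [this, ← map_apply (measurable_mul_const _) hE, map_mul_right, inv_inv, Measure.smul_apply,
    ENNReal.smul_def, smul_eq_mul]

/-- The inversion formula `∫ k(x⁻¹) Δ(x⁻¹) dx = ∫ k(x) dx`. -/
theorem lintegral_inv_modular (k : G → ℝ≥0∞) (hk : Measurable k) :
    ∫⁻ x, k x⁻¹ * modularFn x⁻¹ ∂μ = ∫⁻ x, k x ∂μ := by
  obtain ⟨K, hK⟩ := exists_positiveCompacts_subset (isOpen_univ (X := G)) ⟨1, trivial⟩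
  set f : G → ℝ≥0∞ := Set.indicator K 1 with hf
  have hfm : Measurable f := measurable_one.indicator K.isCompact.measurableSet
  have hI : ∫⁻ x, f x ∂μ = μ K := by
    simp [hf, lintegral_indicator K.isCompact.measurableSet]
  have h1 : ∫⁻ x, ∫⁻ y, f x * k y ∂μ ∂μ = ∫⁻ x, ∫⁻ y, f (y * x) * k x⁻¹ ∂μ ∂μ := by
    rw [lintegral_lintegral (by fun_prop), lintegral_lintegral (by fun_prop)]
    conv_lhs => rw [← (measurePreserving_mul_prod_inv μ μ).map_eq]
    rw [lintegral_map (by fun_prop) (measurePreserving_mul_prod_inv μ μ).measurable]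
  have h2 : ∫⁻ x, ∫⁻ y, f x * k y ∂μ ∂μ = μ K * ∫⁻ y, k y ∂μ := by
    simp_rw [lintegral_const_mul _ hk]
    rw [lintegral_mul_const _ hfm, hI]
  have h3 : ∫⁻ x, ∫⁻ y, f (y * x) * k x⁻¹ ∂μ ∂μ
      = μ K * ∫⁻ x, k x⁻¹ * modularFn x⁻¹ ∂μ := by
    have : ∀ x, ∫⁻ y, f (y * x) * k x⁻¹ ∂μ = μ K * (k x⁻¹ * modularFn x⁻¹) := fun x => by
      rw [lintegral_mul_const _ (by fun_prop), lintegral_mul_right μ f hfm.aemeasurable, hI]; ring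
    simp_rw [this]
    rw [lintegral_const_mul' _ _ K.isCompact.measure_lt_top.ne]
  have h4 := h2.symm.trans (h1.trans h3)
  exact ((ENNReal.mul_right_inj (measure_pos_of_nonempty_interior μ K.interior_nonempty).ne'
    K.isCompact.measure_lt_top.ne).1 h4).symm

theorem measurable_modularFn_inv : Measurable fun g : G => (modularFn g⁻¹ : ℝ≥0∞) := by
  set μ : Measure G := haar
  obtain ⟨K, hK⟩ := exists_positiveCompacts_subset (isOpen_univ (X := G)) ⟨1, trivial⟩
  set f : G → ℝ≥0∞ := Set.indicator K 1 with hf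
  have hfm : Measurable f := measurable_one.indicator K.isCompact.measurableSet
  have hI : ∫⁻ x, f x ∂μ = μ K := by
    simp [hf, lintegral_indicator K.isCompact.measurableSet]
  have h : ∀ x : G, (modularFn x⁻¹ : ℝ≥0∞) = (∫⁻ y, f (y * x) ∂μ) / μ K := fun x => by
    rw [lintegral_mul_right μ f hfm.aemeasurable, hI, ENNReal.mul_div_cancel_right
      (measure_pos_of_nonempty_interior μ K.interior_nonempty).ne'
      K.isCompact.measure_lt_top.ne]
  simp_rw [h]
  have hF : Measurable (fun p : G × G => f (p.2 * p.1)) := by fun_prop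
  exact (Measurable.lintegral_prod_right (ν := μ) hF).div_const _

end Haar

section Swap
variable {G : Type*} [Group G] [TopologicalSpace G] [IsTopologicalGroup G]
  [LocallyCompactSpace G] [SecondCountableTopology G] [T2Space G]
  [MeasurableSpace G] [BorelSpace G] {H : Subgroup G} [LocallyCompactSpace H]

/-- The ratio `Δ_H(h) / Δ_G(h)`. -/
noncomputable def modularRatio (h : H) : ℝ≥0 := modularFn h / modularFn (h : G)

theorem lintegral_swap (μG : Measure G) [IsHaarMeasure μG] (μH : Measure H) [IsHaarMeasure μH]
    (φ : G → ℝ≥0∞) (hφ : AEMeasurable φ μG)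
    (hc : ∀ h : H, ∀ᵐ g ∂μG, φ (g * h) = modularRatio h * φ g)
    (a b : G → ℝ≥0∞) (ha : Measurable a) (hb : Measurable b) :
    ∫⁻ g, φ g * a g * ∫⁻ h : H, b (g * h) ∂μH ∂μG
      = ∫⁻ g, φ g * b g * ∫⁻ h : H, a (g * h) ∂μH ∂μG := by
  wlog hφm : Measurable φ generalizing φ
  · have e := hφ.ae_eq_mk
    have := this (hφ.mk φ) hφ.measurable_mk.aemeasurable (fun h => by
      filter_upwards [hc h, e, (quasiMeasurePreserving_mul_right μG (h : G)).ae e] with g h1 h2 h3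
      rw [← h2, ← h3, h1]) hφ.measurable_mk
    convert this using 1
    · exact lintegral_congr_ae (by filter_upwards [e] with g hg; rw [hg])
    · exact lintegral_congr_ae (by filter_upwards [e] with g hg; rw [hg])
  have key : ∀ h : H, ∫⁻ g, φ g * a g * b (g * h) ∂μG
      = ∫⁻ g, φ g * b g * (a (g * (h : G)⁻¹) * modularFn h⁻¹) ∂μG := fun h => by
    have h1 := lintegral_mul_right μG (fun g => φ (g * (h : G)⁻¹) * a (g * (h : G)⁻¹) * b g)
      (by fun_prop) h
    simp only [mul_inv_cancel_right] at h1
    rw [h1, ← lintegral_const_mul _ (by fun_prop)]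
    refine lintegral_congr_ae ?_
    filter_upwards [hc h⁻¹] with g hg
    simp only [Subgroup.coe_inv] at hg
    rw [hg, modularRatio]
    have h0 : modularFn (h : G)⁻¹ ≠ 0 := (modularFn_pos _).ne'
    rw [Subgroup.coe_inv, ENNReal.coe_div h0]
    have : (modularFn (h : G)⁻¹ : ℝ≥0∞) * ((modularFn h⁻¹ : ℝ≥0∞) / modularFn (h : G)⁻¹)
        = modularFn h⁻¹ := ENNReal.mul_div_cancel (by exact_mod_cast h0) ENNReal.coe_ne_top
    calc _ = ((modularFn (h : G)⁻¹ : ℝ≥0∞) * ((modularFn h⁻¹ : ℝ≥0∞) / modularFn (h : G)⁻¹))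
          * (φ g * a (g * (h : G)⁻¹) * b g) := by ring
      _ = _ := by rw [this]; ring
  have : SecondCountableTopology H := TopologicalSpace.Subtype.secondCountableTopology _
  have hmod := measurable_modularFn_inv (G := H)
  have hcoe : Measurable ((↑) : H → G) := measurable_subtype_coe
  have h1 : Measurable fun p : G × H => φ p.1 * a p.1 * b (p.1 * p.2) :=
    ((hφm.comp measurable_fst).mul (ha.comp measurable_fst)).mul
      (hb.comp (measurable_fst.mul (hcoe.comp measurable_snd)))
  have h2 : Measurable fun p : H × G =>
      φ p.2 * b p.2 * (a (p.2 * (p.1 : G)⁻¹) * modularFn p.1⁻¹) :=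
    ((hφm.comp measurable_snd).mul (hb.comp measurable_snd)).mul
      ((ha.comp (measurable_snd.mul (hcoe.comp measurable_fst).inv)).mul
        (hmod.comp measurable_fst))
  calc _ = ∫⁻ g, ∫⁻ h : H, φ g * a g * b (g * h) ∂μH ∂μG := by
        refine lintegral_congr fun g => ?_
        exact (lintegral_const_mul _ (hb.comp (hcoe.const_mul g))).symm
    _ = ∫⁻ h : H, ∫⁻ g, φ g * a g * b (g * h) ∂μG ∂μH :=
        lintegral_lintegral_swap h1.aemeasurable
    _ = ∫⁻ h : H, ∫⁻ g, φ g * b g * (a (g * (h : G)⁻¹) * modularFn h⁻¹) ∂μG ∂μH :=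
        lintegral_congr key
    _ = ∫⁻ g, ∫⁻ h : H, φ g * b g * (a (g * (h : G)⁻¹) * modularFn h⁻¹) ∂μH ∂μG :=
        lintegral_lintegral_swap h2.aemeasurable
    _ = _ := by
        refine lintegral_congr fun g => ?_
        have e := lintegral_inv_modular μH (fun h : H => a (g * h)) (ha.comp (hcoe.const_mul g))
        rw [← e, ← lintegral_const_mul]
        · rfl
        · exact ((ha.comp (hcoe.const_mul g)).comp measurable_inv).mul hmod

end Swap

section Weight

/-- A continuous function `θ : G → [0, ∞)` with `∫_H θ(gh) dμ_H(h) = 1` for all `g`, and such that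
`C H ∩ supp θ` is compact for every compact subset `C` of `G`. -/
structure WeightFunction {G : Type*} [Group G] [TopologicalSpace G] [MeasurableSpace G]
    (H : Subgroup G) (μH : Measure H) where
  toFun : G → ℝ
  continuous_toFun : Continuous toFun
  nonneg : ∀ g, 0 ≤ toFun g
  integral_eq_one : ∀ g, ∫ h : H, toFun (g * h) ∂μH = 1
  isCompact_inter_tsupport : ∀ C : Set G, IsCompact C →
    IsCompact ((C * (H : Set G)) ∩ tsupport toFun)

/-- The measure `θ μ_G`, with density `θ` with respect to `μ_G`. -/
noncomputable def WeightFunction.measure {G : Type*} [Group G] [TopologicalSpace G]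
    [MeasurableSpace G] {H : Subgroup G} {μH : Measure H} (θ : WeightFunction H μH)
    (μG : Measure G) : Measure G :=
  μG.withDensity fun g => ENNReal.ofReal (θ.toFun g)

end Weight

section Induced

variable {G : Type*} [Group G] [TopologicalSpace G] [IsTopologicalGroup G]
  [LocallyCompactSpace G] [SecondCountableTopology G] [T2Space G]
  [MeasurableSpace G] [BorelSpace G] {H : Subgroup G} [IsClosed (H : Set G)]
  {K : Type*} [NormedAddCommGroup K] [InnerProductSpace ℂ K]
  {μH : Measure H} 

/-- For every `h`, for almost every `g`, `F(gh) = √(Δ_H(h)/Δ_G(h)) σ(h⁻¹) F(g)`. -/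
def IsCovariant (σ : H →* (K ≃ₗᵢ[ℂ] K)) (μG : Measure G) (F : G → K) : Prop :=
  ∀ h : H, ∀ᵐ g ∂μG, F (g * h) = (Real.sqrt (modularRatio h) : ℂ) • σ h⁻¹ (F g)

theorem lintegral_one (θ : WeightFunction H μH) (g : G) :
    ∫⁻ h : H, ENNReal.ofReal (θ.toFun (g * h)) ∂μH = 1 := by
  have h1 := θ.integral_eq_one g
  rw [← ofReal_integral_eq_lintegral_ofReal (integrable_of_integral_eq_one h1)
    (.of_forall fun h => θ.nonneg _), h1, ENNReal.ofReal_one]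

theorem measurable_weight (θ : WeightFunction H μH) :
    Measurable fun g => ENNReal.ofReal (θ.toFun g) :=
  θ.continuous_toFun.measurable.ennreal_ofReal

variable {μG : Measure G} [IsHaarMeasure μG] 

theorem IsCovariant.enorm_sq {σ : H →* (K ≃ₗᵢ[ℂ] K)} {F : G → K} (hF : IsCovariant σ μG F)
    (h : H) : ∀ᵐ g ∂μG, ‖F (g * h)‖ₑ ^ 2 = modularRatio h * ‖F g‖ₑ ^ 2 := by
  filter_upwards [hF h] with g hg
  have h1 : ‖(Real.sqrt (modularRatio h) : ℂ)‖ₑ ^ 2 = modularRatio h := by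
    rw [← ofReal_norm, ← ENNReal.ofReal_pow (norm_nonneg _), Complex.norm_real,
      Real.norm_of_nonneg (Real.sqrt_nonneg _), Real.sq_sqrt (NNReal.coe_nonneg _),
      ENNReal.ofReal_coe_nnreal]
  have h2 : ‖σ h⁻¹ (F g)‖ₑ = ‖F g‖ₑ := by
    rw [← ofReal_norm, ← ofReal_norm, LinearIsometryEquiv.norm_map]
  rw [hg, enorm_smul, mul_pow, h1, h2]

theorem eLpNorm_weight (θ : WeightFunction H μH) {F : G → K} (hF : AEStronglyMeasurable F μG) :
    eLpNorm F 2 (θ.measure μG)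
      = (∫⁻ g, ‖F g‖ₑ ^ 2 * ENNReal.ofReal (θ.toFun g) ∂μG) ^ (1 / 2 : ℝ) := by
  rw [eLpNorm_eq_lintegral_rpow_enorm_toReal (by norm_num) (by norm_num), WeightFunction.measure,
    lintegral_withDensity_eq_lintegral_mul₀ (measurable_weight θ).aemeasurable
      (hF.enorm.pow_const _)]
  simp [mul_comm]

theorem ae_of_ae_weight [IsHaarMeasure μH] (θ : WeightFunction H μH)
    {σ : H →* (K ≃ₗᵢ[ℂ] K)} {F : G → K}
    (hm : AEStronglyMeasurable F μG) (hF : IsCovariant σ μG F)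
    (h0 : F =ᵐ[θ.measure μG] 0) : F =ᵐ[μG] 0 := by
  have h1 := lintegral_swap μG μH (fun g => ‖F g‖ₑ ^ 2) (hm.enorm.pow_const _) hF.enorm_sq
    (fun g => ENNReal.ofReal (θ.toFun g)) 1 (measurable_weight θ) measurable_one
  simp only [Pi.one_apply, lintegral_one, mul_one] at h1
  have h2 : ∀ᵐ g ∂μG, ‖F g‖ₑ ^ 2 * ENNReal.ofReal (θ.toFun g) = 0 := by
    rw [WeightFunction.measure, Filter.EventuallyEq,
      ae_withDensity_iff (measurable_weight θ)] at h0
    filter_upwards [h0] with g hg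
    by_cases h : ENNReal.ofReal (θ.toFun g) = 0
    · rw [h, mul_zero]
    · simp [hg h]
  rw [lintegral_congr_ae (g := 0) (by filter_upwards [h2] with g hg; rw [hg, zero_mul]; rfl)] at h1
  simp only [Pi.zero_apply, lintegral_zero] at h1
  have h3 := (lintegral_eq_zero_iff' (hm.enorm.pow_const _)).1 h1.symm
  filter_upwards [h3] with g hg
  simpa using hg

theorem weight_translate [IsHaarMeasure μH] (θ : WeightFunction H μH)
    {σ : H →* (K ≃ₗᵢ[ℂ] K)} {F : G → K}
    (hm : AEStronglyMeasurable F μG) (hF : IsCovariant σ μG F) (g₀ : G) :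
    eLpNorm (fun g => F (g₀⁻¹ * g)) 2 (θ.measure μG) = eLpNorm F 2 (θ.measure μG) := by
  have hm' : AEStronglyMeasurable (fun g => F (g₀⁻¹ * g)) μG :=
    hm.comp_measurePreserving (measurePreserving_mul_left μG g₀⁻¹)
  rw [eLpNorm_weight θ hm, eLpNorm_weight θ hm']
  congr 1
  have h1 := lintegral_swap μG μH (fun g => ‖F g‖ₑ ^ 2) (hm.enorm.pow_const _) hF.enorm_sq
    (fun g => ENNReal.ofReal (θ.toFun g)) (fun g => ENNReal.ofReal (θ.toFun (g₀ * g)))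
    (measurable_weight θ) ((measurable_weight θ).comp (measurable_const_mul g₀))
  simp only [← mul_assoc, lintegral_one, mul_one] at h1
  have h2 := lintegral_mul_left_eq_self (μ := μG)
    (fun g => ‖F g‖ₑ ^ 2 * ENNReal.ofReal (θ.toFun (g₀ * g))) g₀⁻¹
  simp only [mul_inv_cancel_left] at h2
  rw [h1, h2]

variable [IsHaarMeasure μH]

theorem weight_ac (θ : WeightFunction H μH) (μG : Measure G) : θ.measure μG ≪ μG :=
  withDensity_absolutelyContinuous _ _

variable (σ : H →* (K ≃ₗᵢ[ℂ] K)) (μG) (θ : WeightFunction H μH)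

/-- The space of (classes modulo `μ_G`-negligible sets of) `μ_G`-measurable covariant functions
`F : G → K` with `∫ ‖F(g)‖² θ(g) dμ_G(g) < ∞`. -/
noncomputable def inducedSubmodule : Submodule ℂ (G →ₘ[μG] K) where
  carrier := {F | IsCovariant σ μG F ∧ MemLp F 2 (θ.measure μG)}
  zero_mem' := by
    have h0 : ((0 : G →ₘ[μG] K) : G → K) =ᵐ[μG] 0 := AEEqFun.coeFn_zero
    refine ⟨fun h => ?_, (memLp_congr_ae ((weight_ac θ μG).ae_eq h0)).2 MemLp.zero'⟩
    filter_upwards [h0, (quasiMeasurePreserving_mul_right μG (h : G)).ae h0] with g h1 h2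
    simp [h1, h2]
  add_mem' := by
    rintro F F' ⟨hF, hF2⟩ ⟨hF', hF2'⟩
    have h0 := AEEqFun.coeFn_add F F'
    refine ⟨fun h => ?_, (memLp_congr_ae ((weight_ac θ μG).ae_eq h0)).2 (hF2.add hF2')⟩
    filter_upwards [h0, (quasiMeasurePreserving_mul_right μG (h : G)).ae h0, hF h, hF' h]
      with g h1 h2 h3 h4
    simp [h1, h2, h3, h4]
  smul_mem' := by
    rintro c F ⟨hF, hF2⟩
    have h0 := AEEqFun.coeFn_smul c F
    refine ⟨fun h => ?_, (memLp_congr_ae ((weight_ac θ μG).ae_eq h0)).2 (hF2.const_smul c)⟩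
    filter_upwards [h0, (quasiMeasurePreserving_mul_right μG (h : G)).ae h0, hF h]
      with g h1 h2 h3
    simp [h1, h2, h3, smul_comm c]

/-- The Hilbert space of the induced representation, with the norm of `L²(G, θ μ_G, K)`. -/
def InducedSpace : Type _ := inducedSubmodule μG σ θ

noncomputable instance : AddCommGroup (InducedSpace μG σ θ) :=
  inferInstanceAs (AddCommGroup (inducedSubmodule μG σ θ))

noncomputable instance : Module ℂ (InducedSpace μG σ θ) :=
  inferInstanceAs (Module ℂ (inducedSubmodule μG σ θ))

variable {μG σ θ}

/-- A representative of the class. -/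
noncomputable def InducedSpace.toFun (F : InducedSpace μG σ θ) : G → K := F.1

theorem InducedSpace.covariant (F : InducedSpace μG σ θ) : IsCovariant σ μG F.toFun := F.2.1

theorem InducedSpace.memLp (F : InducedSpace μG σ θ) : MemLp F.toFun 2 (θ.measure μG) := F.2.2

theorem InducedSpace.aestronglyMeasurable (F : InducedSpace μG σ θ) :
    AEStronglyMeasurable F.toFun μG := F.1.aestronglyMeasurable

/-- The embedding in `L²(G, θ μ_G, K)`. -/
noncomputable def InducedSpace.toLp : InducedSpace μG σ θ →ₗ[ℂ] Lp K 2 (θ.measure μG) where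
  toFun F := F.memLp.toLp F.toFun
  map_add' F F' := by
    rw [← MemLp.toLp_add]
    exact MemLp.toLp_congr _ _ ((weight_ac θ μG).ae_eq (AEEqFun.coeFn_add F.1 F'.1))
  map_smul' c F := by
    rw [RingHom.id_apply, ← MemLp.toLp_const_smul]
    exact MemLp.toLp_congr _ _ ((weight_ac θ μG).ae_eq (AEEqFun.coeFn_smul c F.1))

theorem InducedSpace.toLp_injective :
    Function.Injective (InducedSpace.toLp : InducedSpace μG σ θ →ₗ[ℂ] _) := by
  rw [injective_iff_map_eq_zero]
  intro F hF
  have h1 : F.toFun =ᵐ[θ.measure μG] 0 := by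
    have h3 : F.memLp.toLp F.toFun = 0 := hF
    have h4 := F.memLp.coeFn_toLp
    rw [h3] at h4
    exact h4.symm.trans (Lp.coeFn_zero _ _ _)
  have h2 := ae_of_ae_weight θ F.aestronglyMeasurable F.covariant h1
  exact Subtype.ext (AEEqFun.ext (h2.trans AEEqFun.coeFn_zero.symm))

noncomputable instance : NormedAddCommGroup (InducedSpace μG σ θ) :=
  NormedAddCommGroup.induced _ _ InducedSpace.toLp InducedSpace.toLp_injective

noncomputable instance : InnerProductSpace ℂ (InducedSpace μG σ θ) where
  toNormedSpace := NormedSpace.induced ℂ _ _ InducedSpace.toLp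
  inner F F' := inner ℂ F.toLp F'.toLp
  norm_sq_eq_re_inner F := norm_sq_eq_re_inner (𝕜 := ℂ) F.toLp
  conj_inner_symm F F' := inner_conj_symm F.toLp F'.toLp
  add_left F F' F'' := by rw [map_add, inner_add_left]
  smul_left F F' c := by rw [map_smul, inner_smul_left]

theorem InducedSpace.norm_eq (F : InducedSpace μG σ θ) :
    ‖F‖ = (eLpNorm F.toFun 2 (θ.measure μG)).toReal := Lp.norm_toLp _ F.memLp

theorem InducedSpace.ext {F F' : InducedSpace μG σ θ} (h : F.toFun =ᵐ[μG] F'.toFun) : F = F' :=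
  Subtype.ext (AEEqFun.ext h)

/-- Left translation: `(translate g F)(g') = F(g⁻¹ g')` for almost every `g'`. -/
noncomputable def translate (g : G) (F : InducedSpace μG σ θ) : InducedSpace μG σ θ :=
  ⟨F.1.compMeasurePreserving (g⁻¹ * ·) (measurePreserving_mul_left μG g⁻¹), by
    have h0 := F.1.coeFn_compMeasurePreserving (measurePreserving_mul_left μG g⁻¹)
    refine ⟨fun h => ?_, (memLp_congr_ae ((weight_ac θ μG).ae_eq h0)).2 ⟨?_, ?_⟩⟩
    · filter_upwards [h0, (quasiMeasurePreserving_mul_right μG (h : G)).ae h0,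
        (measurePreserving_mul_left μG g⁻¹).quasiMeasurePreserving.ae (F.covariant h)] with x h1 h2 h3
      rw [h1, h2, Function.comp_apply, Function.comp_apply, ← mul_assoc]
      exact h3
    · exact (F.aestronglyMeasurable.comp_measurePreserving
        (measurePreserving_mul_left μG g⁻¹)).mono_ac (weight_ac θ μG)
    · exact (weight_translate θ F.aestronglyMeasurable F.covariant g).trans_lt F.memLp.2⟩

theorem translate_toFun (g : G) (F : InducedSpace μG σ θ) :
    (translate g F).toFun =ᵐ[μG] fun g' => F.toFun (g⁻¹ * g') :=
  F.1.coeFn_compMeasurePreserving (measurePreserving_mul_left μG g⁻¹)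

theorem translate_one (F : InducedSpace μG σ θ) : translate 1 F = F := by
  refine InducedSpace.ext ?_
  filter_upwards [translate_toFun 1 F] with g hg
  simp [hg]

theorem translate_mul (g g' : G) (F : InducedSpace μG σ θ) :
    translate (g * g') F = translate g (translate g' F) := by
  refine InducedSpace.ext ?_
  filter_upwards [translate_toFun (g * g') F, translate_toFun g (translate g' F),
    (measurePreserving_mul_left μG g⁻¹).quasiMeasurePreserving.ae (translate_toFun g' F)]
    with x h1 h2 h3
  rw [h1, h2, h3, mul_inv_rev, mul_assoc]

variable (μG σ θ)

/-- The induced representation of `σ` from `H` to `G`: `(Ind_g F)(g') = F(g⁻¹ g')` almost everywhere. -/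
noncomputable def inducedRep : G →* (InducedSpace μG σ θ ≃ₗᵢ[ℂ] InducedSpace μG σ θ) where
  toFun g :=
    { toFun := translate g
      invFun := translate g⁻¹
      left_inv := fun F => by rw [← translate_mul, inv_mul_cancel, translate_one]
      right_inv := fun F => by rw [← translate_mul, mul_inv_cancel, translate_one]
      map_add' := fun F F' => by
        refine InducedSpace.ext ?_
        have hq := (measurePreserving_mul_left μG g⁻¹).quasiMeasurePreserving
        filter_upwards [translate_toFun g (F + F'), translate_toFun g F, translate_toFun g F',
          hq.ae (AEEqFun.coeFn_add F.1 F'.1),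
          AEEqFun.coeFn_add (translate g F).1 (translate g F').1] with x h1 h2 h3 h4 h5
        rw [h1]
        refine h4.trans (Eq.trans ?_ h5.symm)
        exact congrArg₂ (· + ·) h2.symm h3.symm
      map_smul' := fun c F => by
        refine InducedSpace.ext ?_
        have hq := (measurePreserving_mul_left μG g⁻¹).quasiMeasurePreserving
        filter_upwards [translate_toFun g (c • F), translate_toFun g F,
          hq.ae (AEEqFun.coeFn_smul c F.1),
          AEEqFun.coeFn_smul c (translate g F).1] with x h1 h2 h4 h5
        rw [h1]
        refine h4.trans (Eq.trans ?_ h5.symm)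
        exact congrArg (c • ·) h2.symm
      norm_map' := fun F => by
        have e := weight_translate θ F.aestronglyMeasurable F.covariant g
        rw [← eLpNorm_congr_ae ((weight_ac θ μG).ae_eq (translate_toFun g F))] at e
        exact (InducedSpace.norm_eq _).trans ((congrArg _ e).trans (InducedSpace.norm_eq F).symm) }
  map_one' := LinearIsometryEquiv.ext translate_one
  map_mul' g g' := LinearIsometryEquiv.ext (translate_mul g g')

end Induced

section Admissible

variable {G : Type*} [Group G] [TopologicalSpace G] [MeasurableSpace G]
  {E : Type*} [NormedAddCommGroup E] [InnerProductSpace ℂ E] [CompleteSpace E]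

/-- `π(f) u = ∫ f(g) π(g) u dμ_G(g)` for `f` continuous with compact support. -/
noncomputable def integratedRep (μG : Measure G) (π : G →* (E ≃ₗᵢ[ℂ] E)) (f : C_c(G, ℂ)) (u : E) :
    E := ∫ g, f g • π g u ∂μG

/-- The Gårding domain of `π`: the span of the vectors `π(f) u`. -/
def gardingDomain (μG : Measure G) (π : G →* (E ≃ₗᵢ[ℂ] E)) : Submodule ℂ E :=
  Submodule.span ℂ {v | ∃ (f : C_c(G, ℂ)) (u : E), v = integratedRep μG π f u}

theorem apply_mem_gardingDomain [IsTopologicalGroup G] [BorelSpace G] {μG : Measure G} [μG.IsMulLeftInvariant]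
    {π : G →* (E ≃ₗᵢ[ℂ] E)} (g : G) {v : E} (hv : v ∈ gardingDomain μG π) :
    π g v ∈ gardingDomain μG π := by
  induction hv using Submodule.span_induction with
  | mem x hx =>
    obtain ⟨f, u, rfl⟩ := hx
    refine Submodule.subset_span ⟨⟨⟨fun x => f (g⁻¹ * x), by fun_prop⟩,
      f.hasCompactSupport.comp_homeomorph (Homeomorph.mulLeft g⁻¹)⟩, u, ?_⟩
    have h1 : π g (integratedRep μG π f u) = ∫ x, π g (f x • π x u) ∂μG :=
      ((π g).toLinearIsometry.integral_comp_comm _).symm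
    rw [h1, integratedRep, ← integral_mul_left_eq_self _ g⁻¹]
    refine integral_congr_ae (.of_forall fun x => ?_)
    simp
    rfl
  | zero => simp
  | add x y _ _ hx hy => simpa using add_mem hx hy
  | smul c x _ hx => simpa using Submodule.smul_mem _ c hx

/-- The restriction of `π(g)` to the Gårding domain. -/
def gardingMap [IsTopologicalGroup G] [BorelSpace G] (μG : Measure G) [μG.IsMulLeftInvariant]
    (π : G →* (E ≃ₗᵢ[ℂ] E)) (g : G) (v : gardingDomain μG π) : gardingDomain μG π :=
  ⟨π g v, apply_mem_gardingDomain g v.2⟩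

end Admissible

section Main

variable {G : Type*} [Group G] [TopologicalSpace G] [IsTopologicalGroup G]
  [LocallyCompactSpace G] [SecondCountableTopology G] [T2Space G]
  [MeasurableSpace G] [BorelSpace G] {H : Subgroup G} [IsClosed (H : Set G)]
  {K : Type*} [NormedAddCommGroup K] [InnerProductSpace ℂ K]
  {E : Type*} [NormedAddCommGroup E] [InnerProductSpace ℂ E] [CompleteSpace E]
  {μG : Measure G} [IsHaarMeasure μG] {μH : Measure H}

/-- The function `(W_A v)(g) = A π(g⁻¹) v`. -/
def waveletFun {π : G →* (E ≃ₗᵢ[ℂ] E)} (A : gardingDomain μG π →ₗ[ℂ] K)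
    (v : gardingDomain μG π) (g : G) : K :=
  A (gardingMap μG π g⁻¹ v)

/-- `A` is an admissible map for `π` modulo `(H, σ)`. -/
structure IsAdmissible (σ : H →* (K ≃ₗᵢ[ℂ] K)) (θ : WeightFunction H μH)
    {π : G →* (E ≃ₗᵢ[ℂ] E)} (A : gardingDomain μG π →ₗ[ℂ] K) : Prop where
  semi_invariant : ∀ (h : H) (v : gardingDomain μG π),
    σ h (A v) = (Real.sqrt (modularRatio h) : ℂ) • A (gardingMap μG π (h : G) v)
  measurable : ∀ v : gardingDomain μG π, AEStronglyMeasurable (waveletFun A v) μG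
  square_integrable : ∃ β : ℝ, 0 < β ∧ ∀ v : gardingDomain μG π,
    Integrable (fun g => ‖waveletFun A v g‖ ^ 2 * θ.toFun g) μG ∧
    ∫ g, ‖waveletFun A v g‖ ^ 2 * θ.toFun g ∂μG ≤ β * ‖(v : E)‖ ^ 2

end Main

/-- `π` is (unitarily) equivalent to a sub-representation of `ρ`, that is, to the restriction of
`ρ` to a closed invariant subspace `M`. -/
def IsEquivSubrepresentation {G : Type*} [Group G]
    {E : Type*} [NormedAddCommGroup E] [InnerProductSpace ℂ E]
    {E' : Type*} [NormedAddCommGroup E'] [InnerProductSpace ℂ E']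
    (π : G →* (E ≃ₗᵢ[ℂ] E)) (ρ : G →* (E' ≃ₗᵢ[ℂ] E')) : Prop :=
  ∃ M : Submodule ℂ E', IsClosed (M : Set E') ∧ (∀ g, ∀ x ∈ M, ρ g x ∈ M) ∧
    ∃ T : E ≃ₗᵢ[ℂ] M, ∀ (g : G) (v : E), (T (π g v) : E') = ρ g (T v)

end SqInt

/-!
An isometric intertwining operator `T` from `π` into the induced representation becomes pointwise
evaluation on the Gårding domain. Indeed `T π(f) u` is the vector-valued integral
`∫ f(g) Ind_g (T u) dg`, which is represented by the function `x ↦ ∫ f(g) (T u)(g⁻¹ x) dg`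
(`integral_smul_inducedRep_toFun`), and this function is continuous because elements of the induced
space are locally integrable (`continuous_smoothing`). Continuous representatives are unique, so
`A v = (T v)(1)` is a well-defined linear map with `A π(g⁻¹) v = (T v)(g)` for every `g`; covariance
at every point is the semi-invariance of `A`, and `T` being isometric is the norm identity
(`exists_isAdmissible`).

Conversely, for an admissible map `A` with a lower bound, the wavelet operator
`v ↦ (g ↦ A π(g⁻¹) v)` is bounded, bounded below and intertwining on the Gårding domain. That domain is
dense (`dense_gardingDomain`) and the induced space is complete, so the operator extends to the whole
Hilbert space, and the isometric part of its polar decomposition is again intertwining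
(`isEquivSubrepresentation_of_bounded_below`).

Both local integrability and completeness of the induced space rest on `lintegral_enorm_sq_mul_eq`:
the norm of a covariant function does not change if `θ` is replaced by another density with integral
`1` along each coset `gH`. Left translates of `θ` give bounds on compact sets; a weighted sum of them
over a dense sequence is positive everywhere, which gives an isometric embedding in an `L²` space
whose null sets are those of Haar measure.
-/

namespace SqInt

/-! ### Intertwining operators -/

section Intertwining

variable {G : Type*} [Group G]
  {E : Type*} [NormedAddCommGroup E] [InnerProductSpace ℂ E] [CompleteSpace E]
  {E' : Type*} [NormedAddCommGroup E'] [InnerProductSpace ℂ E']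
  {π : G →* (E ≃ₗᵢ[ℂ] E)} {ρ : G →* (E' ≃ₗᵢ[ℂ] E')}

theorem isEquivSubrepresentation_of_linearIsometry (U : E →ₗᵢ[ℂ] E')
    (hU : ∀ g v, U (π g v) = ρ g (U v)) : IsEquivSubrepresentation π ρ := by
  refine ⟨U.range, U.isometry.isClosedEmbedding.isClosed_range, ?_, U.equivRange, hU⟩
  rintro g _ ⟨v, rfl⟩
  exact ⟨π g v, hU g v⟩

/-- The polar decomposition: if `W` is a bounded intertwining operator that is bounded below, then
`R = (W* W)^(1/2)` is invertible and commutes with `π`, and `W R⁻¹` is an isometric intertwining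
operator. -/
theorem isEquivSubrepresentation_of_bounded_below [CompleteSpace E'] (W : E →L[ℂ] E')
    (hW : ∀ g v, W (π g v) = ρ g (W v)) {α : ℝ} (hα : 0 < α)
    (hb : ∀ v, α * ‖v‖ ^ 2 ≤ ‖W v‖ ^ 2) : IsEquivSubrepresentation π ρ := by
  set S : E →L[ℂ] E := W.adjoint ∘L W with hS
  have hS0 : 0 ≤ S :=
    (ContinuousLinearMap.nonneg_iff_isPositive _).2 (ContinuousLinearMap.isPositive_adjoint_comp_self W)
  have hin : ∀ v w, inner ℂ (S v) w = inner ℂ (W v) (W w) := fun v w => by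
    rw [hS, ContinuousLinearMap.comp_apply, ContinuousLinearMap.adjoint_inner_left]
  set R : E →L[ℂ] E := CFC.sqrt S with hR
  have hRS : R * R = S := CFC.sqrt_mul_sqrt_self S hS0
  have hRsa : IsSelfAdjoint R := (CFC.sqrt_nonneg S).isSelfAdjoint
  have hnorm : ∀ v, ‖R v‖ = ‖W v‖ := fun v => by
    have h1 : inner ℂ (R v) (R v) = inner ℂ (W v) (W v) := by
      rw [← hin, ← hRS, mul_apply_eq_comp]
      conv_rhs => rw [← hRsa.adjoint_eq, ContinuousLinearMap.adjoint_inner_left]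
      rw [hRsa.adjoint_eq]
    rw [inner_self_eq_norm_sq_to_K, inner_self_eq_norm_sq_to_K] at h1
    have h2 : ‖R v‖ ^ 2 = ‖W v‖ ^ 2 := by exact_mod_cast h1
    exact (sq_eq_sq₀ (norm_nonneg _) (norm_nonneg _)).1 h2
  have hunitS : IsUnit S := by
    refine ContinuousLinearMap.isUnit_of_forall_le_norm_inner_map S (c := ⟨α, hα.le⟩) hα fun v => ?_
    rw [hin, inner_self_eq_norm_sq_to_K]
    have := hb v
    simp only [norm_pow, RCLike.norm_ofReal, abs_norm]
    exact (mul_comm _ _).trans_le this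
  have hunitR : IsUnit R := by
    rw [← hRS] at hunitS
    exact ((Commute.refl R).isUnit_mul_iff.1 hunitS).1
  obtain ⟨u, hu⟩ := hunitR
  have hcomm : ∀ g v, R (π g v) = π g (R v) := fun g v => by
    have hgg : ∀ w, π g (π g⁻¹ w) = w := fun w => by
      rw [map_inv]; exact (π g).apply_symm_apply w
    have hc : Commute S ((π g).toContinuousLinearEquiv : E →L[ℂ] E) := by
      refine ContinuousLinearMap.ext fun v => ext_inner_right ℂ fun w => ?_
      have hinv : ∀ w, ρ g (W (π g⁻¹ w)) = W w := fun w => by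
        rw [← hW, hgg]
      have hadj : ∀ x, inner ℂ (π g x) w = inner ℂ x (π g⁻¹ w) := fun x => by
        rw [← (π g).inner_map_map x, hgg]
      change inner ℂ (S (π g v)) w = inner ℂ (π g (S v)) w
      rw [hin, hW, hadj, hin, ← (ρ g).inner_map_map (W v), hinv]
    have hc' : Commute R ((π g).toContinuousLinearEquiv : E →L[ℂ] E) := by
      rw [hR, CFC.sqrt_eq_cfc]
      exact hc.cfc_nnreal _
    exact DFunLike.congr_fun hc'.eq v
  have hRu : ∀ v, R ((↑u⁻¹ : E →L[ℂ] E) v) = v := fun v => by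
    rw [← mul_apply_eq_comp, ← hu, u.mul_inv]; rfl
  have huR : ∀ v, (↑u⁻¹ : E →L[ℂ] E) (R v) = v := fun v => by
    rw [← mul_apply_eq_comp, ← hu, u.inv_mul]; rfl
  refine isEquivSubrepresentation_of_linearIsometry
    ⟨(W ∘L (↑u⁻¹ : E →L[ℂ] E)).toLinearMap, fun v => ?_⟩ fun g v => ?_
  · change ‖W ((↑u⁻¹ : E →L[ℂ] E) v)‖ = ‖v‖
    rw [← hnorm, hRu]
  · change W ((↑u⁻¹ : E →L[ℂ] E) (π g v)) = ρ g (W ((↑u⁻¹ : E →L[ℂ] E) v))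
    rw [← hW]
    congr 1
    conv_lhs => rw [← hRu v, ← hcomm, huR]

end Intertwining

/-! ### Density of the Gårding domain -/

section Garding

variable {G : Type*} [Group G] [TopologicalSpace G] [IsTopologicalGroup G]
  [LocallyCompactSpace G] [MeasurableSpace G] [BorelSpace G]
  {E : Type*} [NormedAddCommGroup E] [InnerProductSpace ℂ E] [CompleteSpace E]
  (μG : Measure G) [IsHaarMeasure μG]

theorem integrable_smul_apply {π : G →* (E ≃ₗᵢ[ℂ] E)} (hπ : ∀ v : E, Continuous fun g => π g v)
    (f : C_c(G, ℂ)) (u : E) : Integrable (fun g => f g • π g u) μG :=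
  (f.continuous.smul (hπ u)).integrable_of_hasCompactSupport f.hasCompactSupport.smul_right

/-- A vector `w` orthogonal to every `π(f) w` vanishes: take for `f` a cut-off of the positive part
of `g ↦ Re ⟪w, π(g) w⟫`. -/
theorem dense_gardingDomain {π : G →* (E ≃ₗᵢ[ℂ] E)} (hπ : ∀ v : E, Continuous fun g => π g v) :
    Dense (gardingDomain μG π : Set E) := by
  rw [Submodule.dense_iff_topologicalClosure_eq_top, Submodule.topologicalClosure_eq_top_iff,
    Submodule.eq_bot_iff]
  intro w hw
  by_contra hne
  set φ : G → ℝ := fun g => RCLike.re (inner ℂ w (π g w)) with hφ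
  have hφc : Continuous φ := RCLike.continuous_re.comp (continuous_const.inner (hπ w))
  have hφ1 : 0 < φ 1 := by
    simp only [hφ, map_one, LinearIsometryEquiv.coe_one, id]
    rw [← norm_sq_eq_re_inner]
    have := norm_pos_iff.2 hne
    positivity
  obtain ⟨k, hk1, -, hkc, hk⟩ := exists_continuous_one_zero_of_isCompact
    (isCompact_singleton (x := (1 : G))) isClosed_empty (Set.disjoint_empty _)
  set r : G → ℝ := fun g => k g * max (φ g) 0 with hr
  have hrc : Continuous r := k.continuous.mul (hφc.max continuous_const)
  have hrs : HasCompactSupport r := hkc.mul_right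
  let f : C_c(G, ℂ) := ⟨⟨fun g => (r g : ℂ), Complex.continuous_ofReal.comp hrc⟩,
    hrs.comp_left (g := fun x : ℝ => (x : ℂ)) (by simp)⟩
  have h0 : inner ℂ w (integratedRep μG π f w) = 0 :=
    (Submodule.mem_orthogonal' _ _).1 hw _ (Submodule.subset_span ⟨f, w, rfl⟩)
  have h1 : ∫ g, r g * φ g ∂μG = 0 := by
    rw [integratedRep, ← integral_inner (integrable_smul_apply μG hπ f w)] at h0
    have hi : Integrable (fun g => inner ℂ w (f g • π g w)) μG :=
      (integrable_smul_apply μG hπ f w).const_inner w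
    have h2 := congrArg RCLike.re h0
    rw [← integral_re hi, map_zero] at h2
    rw [← h2]
    refine integral_congr_ae (.of_forall fun g => ?_)
    change r g * φ g = RCLike.re (inner ℂ w ((r g : ℂ) • π g w))
    rw [inner_smul_right]
    simp [hφ]
  have h3 : 0 < ∫ g, r g * φ g ∂μG := by
    refine Continuous.integral_pos_of_hasCompactSupport_nonneg_nonzero (x := 1) (hrc.mul hφc)
      hrs.mul_right (fun g => ?_) ?_
    · simp only [hr, Pi.zero_apply]
      rcases le_total (φ g) 0 with h | h
      · simp [max_eq_right h]
      · rw [max_eq_left h]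
        exact mul_nonneg (mul_nonneg (hk g).1 h) h
    · have : k 1 = 1 := hk1 rfl
      simp only [hr, this, max_eq_left hφ1.le]
      positivity
  exact h3.ne' h1

end Garding

/-! ### The induced space: local bounds and completeness -/

section InducedSpace

variable {G : Type*} [Group G] [TopologicalSpace G] [IsTopologicalGroup G]
  [LocallyCompactSpace G] [SecondCountableTopology G] [T2Space G]
  [MeasurableSpace G] [BorelSpace G] {H : Subgroup G} [IsClosed (H : Set G)]
  {K : Type*} [NormedAddCommGroup K] [InnerProductSpace ℂ K]
  {μG : Measure G} [IsHaarMeasure μG] {μH : Measure H} [IsHaarMeasure μH]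
  {σ : H →* (K ≃ₗᵢ[ℂ] K)} {θ : WeightFunction H μH}

theorem WeightFunction.exists_pos (θ : WeightFunction H μH) : ∃ x, 0 < θ.toFun x := by
  by_contra! h
  have h0 : ∀ x, θ.toFun x = 0 := fun x => le_antisymm (h x) (θ.nonneg x)
  have := θ.integral_eq_one 1
  simp [h0] at this

/-- The weight `θ` may be replaced by any density whose integrals along the cosets of `H` are `1`,
without changing the norm of a covariant function. -/
theorem lintegral_enorm_sq_mul_eq {F : G → K} (hm : AEStronglyMeasurable F μG)
    (hF : IsCovariant σ μG F) (θ : WeightFunction H μH) {b : G → ℝ≥0∞} (hb : Measurable b)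
    (hb1 : ∀ g, ∫⁻ h : H, b (g * h) ∂μH = 1) :
    ∫⁻ g, ‖F g‖ₑ ^ 2 * b g ∂μG = ∫⁻ g, ‖F g‖ₑ ^ 2 * ENNReal.ofReal (θ.toFun g) ∂μG := by
  have h1 := lintegral_swap μG μH (fun g => ‖F g‖ₑ ^ 2) (hm.enorm.pow_const _) hF.enorm_sq
    b (fun g => ENNReal.ofReal (θ.toFun g)) hb (measurable_weight θ)
  simpa only [lintegral_one, hb1, mul_one] using h1

/-- Every point has a neighbourhood on which some translate of `θ` is bounded below, and the translates
of `θ` all give the same norm; a compact set is covered by finitely many such neighbourhoods. -/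
theorem exists_setLIntegral_enorm_sq_le (μG : Measure G) [IsHaarMeasure μG]
    (σ : H →* (K ≃ₗᵢ[ℂ] K)) (θ : WeightFunction H μH) {C : Set G} (hC : IsCompact C) :
    ∃ c : ℝ≥0∞, c ≠ ∞ ∧ ∀ F : G → K, AEStronglyMeasurable F μG → IsCovariant σ μG F →
      ∫⁻ g in C, ‖F g‖ₑ ^ 2 ∂μG
        ≤ c * ∫⁻ g, ‖F g‖ₑ ^ 2 * ENNReal.ofReal (θ.toFun g) ∂μG := by
  obtain ⟨x₀, hx₀⟩ := θ.exists_pos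
  refine hC.induction_on (p := fun C : Set G => ∃ c : ℝ≥0∞, c ≠ ∞ ∧ ∀ F : G → K,
    AEStronglyMeasurable F μG → IsCovariant σ μG F → ∫⁻ g in C, ‖F g‖ₑ ^ 2 ∂μG
      ≤ c * ∫⁻ g, ‖F g‖ₑ ^ 2 * ENNReal.ofReal (θ.toFun g) ∂μG) ?_ ?_ ?_ ?_
  · exact ⟨0, by simp, fun F _ _ => by simp⟩
  · rintro s t hst ⟨c, hc, h⟩
    exact ⟨c, hc, fun F hm hF => (lintegral_mono_set hst).trans (h F hm hF)⟩
  · rintro s t ⟨c, hc, h⟩ ⟨c', hc', h'⟩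
    refine ⟨c + c', ENNReal.add_ne_top.2 ⟨hc, hc'⟩, fun F hm hF => ?_⟩
    rw [add_mul]
    exact (lintegral_union_le _ _ _).trans (add_le_add (h F hm hF) (h' F hm hF))
  · intro x _
    -- Near `x`, the translate of `θ` that carries the value `θ x₀` to `x` is bounded below.
    set t : ℝ≥0∞ := ENNReal.ofReal (θ.toFun x₀ / 2) with ht
    have ht0 : t ≠ 0 := (ENNReal.ofReal_pos.2 (half_pos hx₀)).ne'
    have hcont : Continuous fun y => θ.toFun (x₀ * x⁻¹ * y) :=
      θ.continuous_toFun.comp (continuous_const_mul _)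
    have hU : {y | θ.toFun x₀ / 2 < θ.toFun (x₀ * x⁻¹ * y)} ∈ nhds x :=
      (isOpen_lt continuous_const hcont).mem_nhds (by simpa using hx₀)
    refine ⟨_, mem_nhdsWithin_of_mem_nhds hU, t⁻¹, ENNReal.inv_ne_top.2 ht0, fun F hm hF => ?_⟩
    have hb : Measurable fun y => ENNReal.ofReal (θ.toFun (x₀ * x⁻¹ * y)) :=
      hcont.measurable.ennreal_ofReal
    rw [← lintegral_enorm_sq_mul_eq hm hF θ hb fun g => by
        simp only [← mul_assoc]; exact lintegral_one θ _,
      ← lintegral_const_mul' _ _ (ENNReal.inv_ne_top.2 ht0)]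
    refine (setLIntegral_mono' (isOpen_lt continuous_const hcont).measurableSet
      fun y hy => ?_).trans (setLIntegral_le_lintegral _ _)
    have h1 : t ≤ ENNReal.ofReal (θ.toFun (x₀ * x⁻¹ * y)) :=
      ENNReal.ofReal_le_ofReal (le_of_lt hy)
    calc ‖F y‖ₑ ^ 2 = t⁻¹ * (‖F y‖ₑ ^ 2 * t) := by
          rw [mul_comm, mul_assoc, ENNReal.mul_inv_cancel ht0 ENNReal.ofReal_ne_top, mul_one]
      _ ≤ _ := by gcongr

theorem InducedSpace.enorm_eq (F : InducedSpace μG σ θ) :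
    ‖F‖ₑ = eLpNorm F.toFun 2 (θ.measure μG) := by
  rw [← ofReal_norm, InducedSpace.norm_eq, ENNReal.ofReal_toReal F.memLp.2.ne]

/-- Norm convergence in the induced space implies convergence in `L¹` over compact sets. -/
theorem exists_setLIntegral_enorm_le (μG : Measure G) [IsHaarMeasure μG]
    (σ : H →* (K ≃ₗᵢ[ℂ] K)) (θ : WeightFunction H μH) {C : Set G} (hC : IsCompact C) :
    ∃ c : ℝ≥0, ∀ F : InducedSpace μG σ θ,
      ∫⁻ g in C, ‖F.toFun g‖ₑ ∂μG ≤ c * ‖F‖ₑ := by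
  obtain ⟨c, hc, h⟩ := exists_setLIntegral_enorm_sq_le μG σ θ hC
  have hfin : c ^ (1 / 2 : ℝ) * μG C ^ (1 / 2 : ℝ) ≠ ∞ :=
    ENNReal.mul_ne_top (ENNReal.rpow_ne_top_of_nonneg (by norm_num) hc)
      (ENNReal.rpow_ne_top_of_nonneg (by norm_num) hC.measure_lt_top.ne)
  refine ⟨(c ^ (1 / 2 : ℝ) * μG C ^ (1 / 2 : ℝ)).toNNReal, fun F => ?_⟩
  rw [ENNReal.coe_toNNReal hfin, F.enorm_eq, eLpNorm_weight θ F.aestronglyMeasurable]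
  have h1 := eLpNorm_le_eLpNorm_mul_rpow_measure_univ (p := 1) (q := 2) (by norm_num)
    (F.aestronglyMeasurable.restrict (s := C))
  rw [eLpNorm_one_eq_lintegral_enorm, eLpNorm_eq_lintegral_rpow_enorm_toReal (by norm_num)
    (by norm_num), Measure.restrict_apply_univ] at h1
  have h2 := ENNReal.rpow_le_rpow (z := 1 / 2) (h F.toFun F.aestronglyMeasurable F.covariant)
    (by norm_num)
  rw [ENNReal.mul_rpow_of_nonneg _ _ (by norm_num)] at h2
  refine h1.trans ?_
  norm_num at h2 ⊢
  calc _ ≤ _ := mul_le_mul_left h2 _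
    _ = _ := by ring

theorem InducedSpace.integrableOn (F : InducedSpace μG σ θ) {C : Set G} (hC : IsCompact C) :
    IntegrableOn F.toFun C μG := by
  obtain ⟨c, hc⟩ := exists_setLIntegral_enorm_le μG σ θ hC
  exact ⟨F.aestronglyMeasurable.restrict,
    (hc F).trans_lt (ENNReal.mul_lt_top ENNReal.coe_lt_top enorm_lt_top)⟩

theorem InducedSpace.coeFn_sub (F F' : InducedSpace μG σ θ) :
    (F - F').toFun =ᵐ[μG] F.toFun - F'.toFun := AEEqFun.coeFn_sub F.1 F'.1

theorem InducedSpace.coeFn_add (F F' : InducedSpace μG σ θ) :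
    (F + F').toFun =ᵐ[μG] F.toFun + F'.toFun := AEEqFun.coeFn_add F.1 F'.1

theorem InducedSpace.coeFn_smul (c : ℂ) (F : InducedSpace μG σ θ) :
    (c • F).toFun =ᵐ[μG] c • F.toFun := AEEqFun.coeFn_smul c F.1

/-- Integration over a compact set, as a bounded operator on the induced space. -/
noncomputable def setIntegralCLM (μG : Measure G) [IsHaarMeasure μG]
    (σ : H →* (K ≃ₗᵢ[ℂ] K)) (θ : WeightFunction H μH) {C : Set G} (hC : IsCompact C) :
    InducedSpace μG σ θ →L[ℂ] K :=
  LinearMap.mkContinuous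
    { toFun := fun F => ∫ g in C, F.toFun g ∂μG
      map_add' := fun F F' => by
        rw [← integral_add (F.integrableOn hC) (F'.integrableOn hC)]
        exact integral_congr_ae (ae_restrict_of_ae (F.coeFn_add F'))
      map_smul' := fun c F => by
        rw [RingHom.id_apply, ← integral_smul]
        exact integral_congr_ae (ae_restrict_of_ae (F.coeFn_smul c)) }
    (exists_setLIntegral_enorm_le μG σ θ hC).choose fun F => by
      have h := (exists_setLIntegral_enorm_le μG σ θ hC).choose_spec F
      refine (norm_integral_le_lintegral_norm _).trans ?_
      refine ENNReal.toReal_le_of_le_ofReal (by positivity) ?_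
      rw [ENNReal.ofReal_mul (NNReal.coe_nonneg _), ENNReal.ofReal_coe_nnreal, ofReal_norm]
      simpa only [ofReal_norm] using h

theorem setIntegralCLM_apply {C : Set G} (hC : IsCompact C) (F : InducedSpace μG σ θ) :
    setIntegralCLM μG σ θ hC F = ∫ g in C, F.toFun g ∂μG := rfl

/-- A density that is positive everywhere and has integral `1` along each coset of `H`: a weighted
sum of translates of `θ` over a dense sequence. -/
theorem WeightFunction.exists_measurable_pos (θ : WeightFunction H μH) :
    ∃ b : G → ℝ≥0∞, Measurable b ∧ (∀ g, b g ≠ 0) ∧ ∀ g, ∫⁻ h : H, b (g * h) ∂μH = 1 := by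
  set s := TopologicalSpace.denseSeq G
  have hm : ∀ k, Measurable fun g => (2⁻¹ : ℝ≥0∞) ^ (k + 1) * ENNReal.ofReal (θ.toFun (s k * g)) :=
    fun k => ((measurable_weight θ).comp (measurable_const_mul (s k))).const_mul _
  refine ⟨fun g => ∑' k, (2⁻¹ : ℝ≥0∞) ^ (k + 1) * ENNReal.ofReal (θ.toFun (s k * g)),
    .tsum hm, fun g => ?_, fun g => ?_⟩
  · obtain ⟨x₀, hx₀⟩ := θ.exists_pos
    have hcont : Continuous fun y => θ.toFun (y * g) :=
      θ.continuous_toFun.comp (continuous_mul_const g)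
    obtain ⟨k, hk⟩ := (TopologicalSpace.denseRange_denseSeq G).exists_mem_open
      (isOpen_lt continuous_const hcont) ⟨x₀ * g⁻¹, by simpa using hx₀⟩
    refine (ENNReal.tsum_eq_zero.not.2 fun h => ?_)
    rcases mul_eq_zero.1 (h k) with h | h
    · exact pow_ne_zero _ (by simp) h
    · exact (ENNReal.ofReal_pos.2 hk).ne' h
  · have hcoe : Measurable fun h : H => g * (h : G) := measurable_subtype_coe.const_mul g
    refine (lintegral_tsum fun k => ((hm k).comp hcoe).aemeasurable).trans ?_
    simp only [Function.comp_apply]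
    have h1 : ∀ k, ∫⁻ h : H, (2⁻¹ : ℝ≥0∞) ^ (k + 1) * ENNReal.ofReal (θ.toFun (s k * (g * h))) ∂μH
        = 2⁻¹ ^ (k + 1) := fun k => by
      rw [lintegral_const_mul' _ _ (ENNReal.pow_ne_top (by simp))]
      simp only [← mul_assoc, lintegral_one, mul_one]
    simp_rw [h1]
    rw [ENNReal.tsum_geometric_add_one, ENNReal.one_sub_inv_two, inv_inv,
      ENNReal.inv_mul_cancel two_ne_zero ENNReal.ofNat_ne_top]

/-- With a density `b > 0` of integral `1` along the cosets of `H`, the induced space embeds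
isometrically in `L²(b μ_G)`. Since `b μ_G` and `μ_G` have the same null sets, `L²` limits are
almost everywhere limits of a subsequence, so covariance passes to them. -/
instance [CompleteSpace K] : CompleteSpace (InducedSpace μG σ θ) := by
  obtain ⟨b, hbm, hb0, hb1⟩ := θ.exists_measurable_pos
  set ν : Measure G := μG.withDensity b with hν
  have hνμ : ν ≪ μG := withDensity_absolutelyContinuous _ _
  have hμν : μG ≪ ν := withDensity_absolutelyContinuous' hbm.aemeasurable (.of_forall hb0)
  have hnorm : ∀ F : G → K, AEStronglyMeasurable F μG → IsCovariant σ μG F →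
      eLpNorm F 2 ν = eLpNorm F 2 (θ.measure μG) := fun F hm hF => by
    rw [eLpNorm_weight θ hm, eLpNorm_eq_lintegral_rpow_enorm_toReal (by norm_num) (by norm_num),
      hν, lintegral_withDensity_eq_lintegral_mul₀ hbm.aemeasurable (hm.enorm.pow_const _)]
    simp only [ENNReal.toReal_ofNat, ENNReal.rpow_ofNat, Pi.mul_apply]
    simp_rw [mul_comm (b _)]
    rw [lintegral_enorm_sq_mul_eq hm hF θ hbm hb1]
  have hLp : ∀ F : InducedSpace μG σ θ, MemLp F.toFun 2 ν := fun F =>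
    ⟨F.aestronglyMeasurable.mono_ac hνμ, by
      rw [hnorm _ F.aestronglyMeasurable F.covariant]; exact F.memLp.2⟩
  refine Metric.complete_of_cauchySeq_tendsto fun u hu => ?_
  set f : ℕ → Lp K 2 ν := fun n => (hLp (u n)).toLp _ with hf
  have hdist : ∀ m n, dist (f m) (f n) = dist (u m) (u n) := fun m n => by
    rw [dist_eq_norm, dist_eq_norm, hf, ← MemLp.toLp_sub, Lp.norm_toLp, InducedSpace.norm_eq,
      ← hnorm _ (u m - u n).aestronglyMeasurable (u m - u n).covariant,
      eLpNorm_congr_ae (hνμ.ae_eq (InducedSpace.coeFn_sub (u m) (u n)))]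
  have hfc : CauchySeq f := by
    rw [Metric.cauchySeq_iff] at hu ⊢
    simpa only [hdist] using hu
  obtain ⟨l, hl⟩ := cauchySeq_tendsto_of_complete hfc
  obtain ⟨ns, -, hae⟩ := (tendstoInMeasure_of_tendsto_Lp hl).exists_seq_tendsto_ae
  have hae' : ∀ᵐ x ∂μG, Filter.Tendsto (fun i => (u (ns i)).toFun x) Filter.atTop (nhds (l x)) := by
    have h1 : ∀ᵐ x ∂μG, ∀ n, f n x = (u n).toFun x :=
      ae_all_iff.2 fun n => hμν.ae_le (hLp (u n)).coeFn_toLp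
    filter_upwards [hμν.ae_le hae, h1] with x hx h2
    simpa only [h2] using hx
  have hlm : AEStronglyMeasurable l μG := (Lp.aestronglyMeasurable l).mono_ac hμν
  have hlc : IsCovariant σ μG l := fun h => by
    have h1 : ∀ᵐ g ∂μG, ∀ n, (u n).toFun (g * h)
        = (Real.sqrt (modularRatio h) : ℂ) • σ h⁻¹ ((u n).toFun g) :=
      ae_all_iff.2 fun n => (u n).covariant h
    filter_upwards [h1, hae', (quasiMeasurePreserving_mul_right μG (h : G)).ae hae'] with g h2 h3 h4
    refine tendsto_nhds_unique h4 ?_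
    simp only [h2]
    exact (((σ h⁻¹).continuous.tendsto _).comp h3).const_smul _
  have hmk : AEEqFun.mk l hlm =ᵐ[μG] l := AEEqFun.coeFn_mk _ _
  let F : InducedSpace μG σ θ := ⟨AEEqFun.mk l hlm, fun h => by
      filter_upwards [hlc h, hmk, (quasiMeasurePreserving_mul_right μG (h : G)).ae hmk]
        with g h1 h2 h3
      rw [h2, h3, h1], (memLp_congr_ae ((weight_ac θ μG).ae_eq hmk)).2
      ⟨hlm.mono_ac (weight_ac θ μG), by
        rw [← hnorm _ hlm hlc]; exact (Lp.memLp l).2⟩⟩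
  have hF : (hLp F).toLp _ = l := Lp.ext ((hLp F).coeFn_toLp.trans (hνμ.ae_eq hmk))
  refine ⟨F, ?_⟩
  rw [tendsto_iff_dist_tendsto_zero] at hl ⊢
  refine hl.congr fun n => ?_
  rw [← hF, dist_eq_norm, dist_eq_norm, hf, ← MemLp.toLp_sub, Lp.norm_toLp, InducedSpace.norm_eq,
      ← hnorm _ (u n - F).aestronglyMeasurable (u n - F).covariant,
      eLpNorm_congr_ae (hνμ.ae_eq (InducedSpace.coeFn_sub (u n) F))]

theorem memLp_weight_iff {F : G → K} (hm : AEStronglyMeasurable F μG) :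
    MemLp F 2 (θ.measure μG) ↔ Integrable (fun g => ‖F g‖ ^ 2 * θ.toFun g) μG := by
  rw [memLp_two_iff_integrable_sq_norm (hm.mono_ac (weight_ac θ μG)), WeightFunction.measure,
    integrable_withDensity_iff_integrable_smul' (measurable_weight θ)
      (.of_forall fun _ => ENNReal.ofReal_lt_top)]
  simp only [ENNReal.toReal_ofReal (θ.nonneg _), smul_eq_mul, mul_comm]

theorem InducedSpace.norm_sq_eq (F : InducedSpace μG σ θ) :
    ‖F‖ ^ 2 = ∫ g, ‖F.toFun g‖ ^ 2 * θ.toFun g ∂μG := by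
  have h1 : ‖F‖ ^ 2 = ∫ g, ‖F.toFun g‖ ^ 2 ∂(θ.measure μG) := by
    rw [InducedSpace.norm_eq, F.memLp.eLpNorm_eq_integral_rpow_norm (by norm_num) (by norm_num),
      ENNReal.toReal_ofReal (by positivity)]
    simp only [ENNReal.toReal_ofNat, Real.rpow_ofNat]
    rw [← Real.rpow_natCast, ← Real.rpow_mul (integral_nonneg fun _ => by positivity)]
    norm_num
  rw [h1, WeightFunction.measure, integral_withDensity_eq_integral_toReal_smul (measurable_weight θ)
    (.of_forall fun _ => ENNReal.ofReal_lt_top)]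
  simp only [ENNReal.toReal_ofReal (θ.nonneg _), smul_eq_mul, mul_comm]

end InducedSpace

/-! ### Smoothing by the induced representation -/

section Smoothing

/-- If `V` is compact with nonempty interior, then `Δ(g) μ(V) = μ(V g) ≤ μ(V C)` for `g ∈ C`. -/
theorem modularFn_le_of_isCompact {G : Type*} [Group G] [TopologicalSpace G] [IsTopologicalGroup G]
    [LocallyCompactSpace G] [SecondCountableTopology G] [T2Space G] {C : Set G}
    (hC : IsCompact C) : ∃ c : ℝ≥0, ∀ g ∈ C, modularFn g ≤ c := by
  borelize G
  set μ : Measure G := haar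
  obtain ⟨V, -⟩ := exists_positiveCompacts_subset (isOpen_univ (X := G)) ⟨1, trivial⟩
  have hV0 : μ V ≠ 0 := (measure_pos_of_nonempty_interior μ V.interior_nonempty).ne'
  have hV : μ V ≠ ∞ := V.isCompact.measure_lt_top.ne
  have hVC : μ (V * C) ≠ ∞ := (V.isCompact.mul hC).measure_lt_top.ne
  refine ⟨(μ (V * C) / μ V).toNNReal, fun g hg => ?_⟩
  rw [← ENNReal.coe_le_coe, ENNReal.coe_toNNReal (ENNReal.div_ne_top hVC hV0),
    ENNReal.le_div_iff_mul_le (.inl hV0) (.inl hV),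
    ← measure_mul_right μ V V.isCompact.measurableSet]
  refine measure_mono ?_
  rintro _ ⟨x, hx, rfl⟩
  exact Set.mul_mem_mul hx hg

variable {G : Type*} [Group G] [TopologicalSpace G] [IsTopologicalGroup G]
  [LocallyCompactSpace G] [SecondCountableTopology G] [T2Space G]
  [MeasurableSpace G] [BorelSpace G] {H : Subgroup G} [IsClosed (H : Set G)]
  {K : Type*} [NormedAddCommGroup K] [InnerProductSpace ℂ K]
  {μG : Measure G} [IsHaarMeasure μG] {μH : Measure H} [IsHaarMeasure μH]
  {σ : H →* (K ≃ₗᵢ[ℂ] K)} {θ : WeightFunction H μH}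

/-- Inversion has Jacobian `Δ(g⁻¹)`, which is bounded on compact sets. -/
theorem integrableOn_comp_inv {F : G → K} {C : Set G} (hC : IsCompact C)
    (hF : IntegrableOn F C⁻¹ μG) (hm : AEStronglyMeasurable F μG) :
    IntegrableOn (fun g => F g⁻¹) C μG := by
  have hq := quasiMeasurePreserving_inv μG
  refine ⟨(hm.comp_quasiMeasurePreserving hq).restrict, ?_⟩
  obtain ⟨c, hc⟩ := modularFn_le_of_isCompact hC
  set F' : G → K := hm.mk F
  have hFF : F =ᵐ[μG] F' := hm.ae_eq_mk
  have hF'm : Measurable fun g => ‖F' g‖ₑ := hm.stronglyMeasurable_mk.enorm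
  set k : G → ℝ≥0∞ := (C⁻¹).indicator fun g => ‖F' g‖ₑ * modularFn g⁻¹ with hk
  have hkm : Measurable k :=
    (hF'm.mul measurable_modularFn_inv).indicator hC.inv.measurableSet
  calc ∫⁻ g in C, ‖F g⁻¹‖ₑ ∂μG = ∫⁻ g in C, ‖F' g⁻¹‖ₑ ∂μG := by
        refine lintegral_congr_ae (ae_restrict_of_ae ?_)
        filter_upwards [hq.ae hFF] with g hg
        rw [hg]
    _ = ∫⁻ g, k g⁻¹ * modularFn g⁻¹ ∂μG := by
        rw [← lintegral_indicator hC.measurableSet]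
        refine lintegral_congr fun g => ?_
        by_cases hg : g ∈ C
        · have h0 : modularFn g ≠ 0 := (modularFn_pos g).ne'
          have h1 : (modularFn g : ℝ≥0∞) * modularFn g⁻¹ = 1 := by
            rw [modularFn_inv, ← ENNReal.coe_mul, mul_inv_cancel₀ h0, ENNReal.coe_one]
          rw [Set.indicator_of_mem hg, hk, Set.indicator_of_mem (Set.inv_mem_inv.2 hg), inv_inv,
            mul_assoc, h1, mul_one]
        · rw [Set.indicator_of_notMem hg, hk,
            Set.indicator_of_notMem fun h => hg (Set.inv_mem_inv.1 h), zero_mul]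
    _ = ∫⁻ g, k g ∂μG := lintegral_inv_modular μG k hkm
    _ = ∫⁻ g in C⁻¹, ‖F' g‖ₑ * modularFn g⁻¹ ∂μG := lintegral_indicator hC.inv.measurableSet _
    _ ≤ ∫⁻ g in C⁻¹, ‖F' g‖ₑ * c ∂μG := by
        refine setLIntegral_mono' hC.inv.measurableSet fun g hg => ?_
        gcongr
        exact hc _ hg
    _ = (∫⁻ g in C⁻¹, ‖F g‖ₑ ∂μG) * c := by
        rw [lintegral_mul_const _ hF'm]
        congr 1
        refine lintegral_congr_ae (ae_restrict_of_ae ?_)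
        filter_upwards [hFF] with g hg
        rw [hg]
    _ < ∞ := ENNReal.mul_lt_top hF.2 ENNReal.coe_lt_top

/-- Substituting `x g` for `g` moves the dependence on `x` from the locally integrable function `F`
to the continuous, compactly supported function `f`. -/
theorem continuous_smoothing (f : C_c(G, ℂ)) {F : G → K} (hm : AEStronglyMeasurable F μG)
    (hF : ∀ C, IsCompact C → IntegrableOn F C μG) :
    Continuous fun x => ∫ g, f g • F (g⁻¹ * x) ∂μG := by
  have h1 : ∀ x, ∫ g, f g • F (g⁻¹ * x) ∂μG = ∫ g, f (x * g) • F g⁻¹ ∂μG := fun x => by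
    rw [← integral_mul_left_eq_self _ x]
    simp [mul_assoc]
  simp_rw [h1]
  refine continuous_iff_continuousAt.2 fun x₀ => ?_
  obtain ⟨N, hN, hx₀⟩ := exists_compact_mem_nhds x₀
  have hk : IsCompact (N⁻¹ * tsupport f) := hN.inv.mul f.hasCompactSupport
  refine ContinuousOn.continuousAt (s := N) ?_ hx₀
  refine continuousOn_integral_bilinear_of_locally_integrable_of_compact_support
    (ContinuousLinearMap.lsmul ℂ ℂ : ℂ →L[ℂ] K →L[ℂ] K).flip (k := N⁻¹ * tsupport f)
    (f := fun x g => f (x * g)) (g := fun g => F g⁻¹) hk ?_ ?_ ?_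
  · exact (f.continuous.comp continuous_mul).continuousOn
  · intro p x hp hx
    by_contra h
    exact hx ⟨p⁻¹, Set.inv_mem_inv.2 hp, p * x, subset_tsupport _ h, by simp⟩
  · exact integrableOn_comp_inv hk (hF _ hk.inv) hm

/-- The vector-valued integral `∫ f(g) Ind_g F dg` in the induced space is represented by the
function `x ↦ ∫ f(g) F(g⁻¹ x) dg`: both have the same integral over every compact set. -/
theorem integral_smul_inducedRep_toFun [CompleteSpace K] (f : C_c(G, ℂ)) (F : InducedSpace μG σ θ)
    (hi : Integrable (fun g => f g • inducedRep μG σ θ g F) μG) :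
    (∫ g, f g • inducedRep μG σ θ g F ∂μG).toFun
      =ᵐ[μG] fun x => ∫ g, f g • F.toFun (g⁻¹ * x) ∂μG := by
  set Φ := ∫ g, f g • inducedRep μG σ θ g F ∂μG with hΦ
  have hcont := continuous_smoothing f F.aestronglyMeasurable fun C hC => F.integrableOn hC
  have hae : ∀ g, (f g • inducedRep μG σ θ g F).toFun
      =ᵐ[μG] fun x => f g • F.toFun (g⁻¹ * x) := fun g => by
    filter_upwards [InducedSpace.coeFn_smul (f g) (inducedRep μG σ θ g F),
      translate_toFun g F] with x h1 h2
    rw [h1, Pi.smul_apply, ← h2]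
    rfl
  have hloc : LocallyIntegrable
      (Φ.toFun - fun x => ∫ g, f g • F.toFun (g⁻¹ * x) ∂μG) μG :=
    (locallyIntegrable_iff.2 fun C hC => Φ.integrableOn hC).sub hcont.locallyIntegrable
  have h0 := ae_eq_zero_of_forall_setIntegral_isCompact_eq_zero' hloc fun C hC => by
    obtain ⟨c, hc⟩ := exists_setLIntegral_enorm_le μG σ θ hC
    have hprod : Integrable (Function.uncurry fun g x => f g • F.toFun (g⁻¹ * x))
        (μG.prod (μG.restrict C)) := by
      have hm : AEStronglyMeasurable (Function.uncurry fun g x => f g • F.toFun (g⁻¹ * x))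
          (μG.prod (μG.restrict C)) := by
        refine AEStronglyMeasurable.mono_ac (μ := μG.prod μG)
          (AbsolutelyContinuous.rfl.prod restrict_le_self.absolutelyContinuous) ?_
        exact (f.continuous.comp continuous_fst).aestronglyMeasurable.smul
          (F.aestronglyMeasurable.comp_quasiMeasurePreserving
            (quasiMeasurePreserving_inv_mul μG μG))
      refine ⟨hm, ?_⟩
      rw [hasFiniteIntegral_iff_enorm, lintegral_prod _ hm.enorm]
      calc ∫⁻ g, ∫⁻ x in C, ‖f g • F.toFun (g⁻¹ * x)‖ₑ ∂μG ∂μG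
          = ∫⁻ g, ∫⁻ x in C, ‖(f g • inducedRep μG σ θ g F).toFun x‖ₑ ∂μG ∂μG := by
            refine lintegral_congr fun g => lintegral_congr_ae (ae_restrict_of_ae ?_)
            filter_upwards [hae g] with x hx
            rw [hx]
        _ ≤ ∫⁻ g, c * ‖f g • inducedRep μG σ θ g F‖ₑ ∂μG := lintegral_mono fun g => hc _
        _ = c * ∫⁻ g, ‖f g • inducedRep μG σ θ g F‖ₑ ∂μG :=
            lintegral_const_mul' _ _ ENNReal.coe_ne_top
        _ < ∞ := ENNReal.mul_lt_top ENNReal.coe_lt_top hi.2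
    have h1 : ∫ x in C, Φ.toFun x ∂μG = ∫ x in C, ∫ g, f g • F.toFun (g⁻¹ * x) ∂μG ∂μG := by
      rw [← setIntegralCLM_apply hC, hΦ, ← ContinuousLinearMap.integral_comp_comm _ hi,
        ← integral_integral_swap hprod]
      refine integral_congr_ae (.of_forall fun g => ?_)
      simp only [setIntegralCLM_apply]
      exact integral_congr_ae (ae_restrict_of_ae (hae g))
    have h2 : ∫ x in C, (Φ.toFun - fun x => ∫ g, f g • F.toFun (g⁻¹ * x) ∂μG) x ∂μG
        = ∫ x in C, Φ.toFun x ∂μG - ∫ x in C, ∫ g, f g • F.toFun (g⁻¹ * x) ∂μG ∂μG :=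
      integral_sub (Φ.integrableOn hC)
        (hcont.locallyIntegrable.integrableOn_isCompact hC)
    rw [h2, h1, sub_self]
  filter_upwards [h0] with x hx
  exact sub_eq_zero.1 hx

end Smoothing

/-! ### Continuous elements of the induced space -/

section ContinuousElements

variable {G : Type*} [Group G] [TopologicalSpace G] [IsTopologicalGroup G]
  [LocallyCompactSpace G] [SecondCountableTopology G] [T2Space G]
  [MeasurableSpace G] [BorelSpace G] {H : Subgroup G} [IsClosed (H : Set G)]
  {K : Type*} [NormedAddCommGroup K] [InnerProductSpace ℂ K]
  (μG : Measure G) [IsHaarMeasure μG] {μH : Measure H} [IsHaarMeasure μH]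
  (σ : H →* (K ≃ₗᵢ[ℂ] K)) (θ : WeightFunction H μH)

/-- The classes that contain a continuous function. -/
noncomputable def continuousElements : Submodule ℂ (InducedSpace μG σ θ) where
  carrier := {F | ∃ c : G → K, Continuous c ∧ F.toFun =ᵐ[μG] c}
  zero_mem' := ⟨0, continuous_zero, AEEqFun.coeFn_zero⟩
  add_mem' := by
    rintro F F' ⟨c, hc, h⟩ ⟨c', hc', h'⟩
    exact ⟨c + c', hc.add hc', (F.coeFn_add F').trans (h.add h')⟩
  smul_mem' := by
    rintro a F ⟨c, hc, h⟩
    exact ⟨a • c, hc.const_smul a, (F.coeFn_smul a).trans (h.const_smul a)⟩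

variable {μG σ θ}

/-- The continuous representative, which is unique because Haar measure charges open sets. -/
noncomputable def contRep (F : continuousElements μG σ θ) : G → K := F.2.choose

theorem continuous_contRep (F : continuousElements μG σ θ) : Continuous (contRep F) :=
  F.2.choose_spec.1

theorem toFun_ae_eq_contRep (F : continuousElements μG σ θ) :
    (F : InducedSpace μG σ θ).toFun =ᵐ[μG] contRep F := F.2.choose_spec.2

theorem contRep_eq (F : continuousElements μG σ θ) {c : G → K} (hc : Continuous c)
    (h : (F : InducedSpace μG σ θ).toFun =ᵐ[μG] c) : contRep F = c :=
  ((continuous_contRep F).ae_eq_iff_eq μG hc).1 ((toFun_ae_eq_contRep F).symm.trans h)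

variable (μG σ θ) in
/-- Evaluation of the continuous representative at `1`. -/
noncomputable def evalOne : continuousElements μG σ θ →ₗ[ℂ] K where
  toFun F := contRep F 1
  map_add' F F' := by
    have h := contRep_eq (F + F') ((continuous_contRep F).add (continuous_contRep F'))
      ((InducedSpace.coeFn_add _ _).trans ((toFun_ae_eq_contRep F).add (toFun_ae_eq_contRep F')))
    simp [h]
  map_smul' a F := by
    have h := contRep_eq (a • F) ((continuous_contRep F).const_smul a)
      ((InducedSpace.coeFn_smul _ _).trans ((toFun_ae_eq_contRep F).const_smul a))
    simp [h]

/-- Covariance holds everywhere for the continuous representative. -/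
theorem contRep_mul (F : continuousElements μG σ θ) (g : G) (h : H) :
    contRep F (g * h) = (Real.sqrt (modularRatio h) : ℂ) • σ h⁻¹ (contRep F g) := by
  have hc := continuous_contRep F
  have hF := toFun_ae_eq_contRep F
  refine congrFun ((Continuous.ae_eq_iff_eq μG (f := fun g => contRep F (g * h))
    (g := fun g => (Real.sqrt (modularRatio h) : ℂ) • σ h⁻¹ (contRep F g))
    (hc.comp (continuous_mul_const _))
    (((σ h⁻¹).continuous.comp hc).const_smul _)).1 ?_) g
  filter_upwards [F.1.covariant h, hF, (quasiMeasurePreserving_mul_right μG (h : G)).ae hF]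
    with x h1 h2 h3
  rw [← h2, ← h3, h1]

theorem contRep_inducedRep {F F' : continuousElements μG σ θ} {g : G}
    (h : (F' : InducedSpace μG σ θ) = inducedRep μG σ θ g F) (x : G) :
    contRep F' x = contRep F (g⁻¹ * x) := by
  have := contRep_eq F' (c := fun x => contRep F (g⁻¹ * x))
    ((continuous_contRep F).comp (continuous_const_mul _)) (by
      rw [h]
      filter_upwards [translate_toFun g (F : InducedSpace μG σ θ),
        (measurePreserving_mul_left μG g⁻¹).quasiMeasurePreserving.ae (toFun_ae_eq_contRep F)]
        with y h1 h2
      rw [← h2, ← h1]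
      rfl)
  rw [this]

end ContinuousElements

/-! ### Admissible maps and intertwining operators -/

section Wavelet

variable {G : Type*} [Group G] [TopologicalSpace G] [IsTopologicalGroup G]
  [LocallyCompactSpace G] [SecondCountableTopology G] [T2Space G]
  [MeasurableSpace G] [BorelSpace G] {H : Subgroup G} [IsClosed (H : Set G)]
  {K : Type*} [NormedAddCommGroup K] [InnerProductSpace ℂ K]
  {E : Type*} [NormedAddCommGroup E] [InnerProductSpace ℂ E] [CompleteSpace E]
  {μG : Measure G} [IsHaarMeasure μG] {μH : Measure H} [IsHaarMeasure μH]
  {σ : H →* (K ≃ₗᵢ[ℂ] K)} {θ : WeightFunction H μH} {π : G →* (E ≃ₗᵢ[ℂ] E)}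

theorem gardingMap_gardingMap (g g' : G) (v : gardingDomain μG π) :
    gardingMap μG π g (gardingMap μG π g' v) = gardingMap μG π (g * g') v :=
  Subtype.ext (by simp [gardingMap])

theorem IsAdmissible.isCovariant {A : gardingDomain μG π →ₗ[ℂ] K} (hA : IsAdmissible σ θ A)
    (v : gardingDomain μG π) : IsCovariant σ μG (waveletFun A v) := fun h => by
  refine .of_forall fun g => ?_
  have h1 := hA.semi_invariant h⁻¹ (gardingMap μG π g⁻¹ v)
  rw [gardingMap_gardingMap] at h1
  have h2 : (modularRatio h : ℝ) * modularRatio h⁻¹ = 1 := by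
    have : SecondCountableTopology H := TopologicalSpace.Subtype.secondCountableTopology _
    have e1 : modularFn h ≠ 0 := (modularFn_pos h).ne'
    have e2 : modularFn (h : G) ≠ 0 := (modularFn_pos (h : G)).ne'
    rw [← NNReal.coe_mul, modularRatio, modularRatio, Subgroup.coe_inv, modularFn_inv,
      modularFn_inv]
    norm_cast
    field_simp
  have h3 : (Real.sqrt (modularRatio h) : ℂ) * (Real.sqrt (modularRatio h⁻¹) : ℂ) = 1 := by
    rw [← Complex.ofReal_mul, ← Real.sqrt_mul (NNReal.coe_nonneg _), h2]
    simp
  simp only [waveletFun]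
  rw [h1, smul_smul, h3, one_smul, mul_inv_rev, Subgroup.coe_inv]

/-- The wavelet operator `v ↦ (g ↦ A π(g⁻¹) v)` from the Gårding domain to the induced space. -/
noncomputable def waveletOp {A : gardingDomain μG π →ₗ[ℂ] K} (hA : IsAdmissible σ θ A) :
    gardingDomain μG π →ₗ[ℂ] InducedSpace μG σ θ where
  toFun v := ⟨AEEqFun.mk (waveletFun A v) (hA.measurable v), by
    have hmk := AEEqFun.coeFn_mk _ (hA.measurable v)
    refine ⟨fun h => ?_, (memLp_congr_ae ((weight_ac θ μG).ae_eq hmk)).2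
      ((memLp_weight_iff (hA.measurable v)).2 ?_)⟩
    · filter_upwards [hA.isCovariant v h, hmk,
        (quasiMeasurePreserving_mul_right μG (h : G)).ae hmk] with g h1 h2 h3
      rw [h2, h3, h1]
    · obtain ⟨β, -, h⟩ := hA.square_integrable
      exact (h v).1⟩
  map_add' v w := Subtype.ext <| AEEqFun.mk_eq_mk.2 <| .of_forall fun g => by
    have : gardingMap μG π g⁻¹ (v + w) = gardingMap μG π g⁻¹ v + gardingMap μG π g⁻¹ w :=
      Subtype.ext (map_add (π g⁻¹) (v : E) w)
    simp [waveletFun, this]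
  map_smul' a v := Subtype.ext <| AEEqFun.mk_eq_mk.2 <| .of_forall fun g => by
    have : gardingMap μG π g⁻¹ (a • v) = a • gardingMap μG π g⁻¹ v :=
      Subtype.ext (map_smul (π g⁻¹) a (v : E))
    simp [waveletFun, this]

theorem waveletOp_toFun {A : gardingDomain μG π →ₗ[ℂ] K} (hA : IsAdmissible σ θ A)
    (v : gardingDomain μG π) : (waveletOp hA v).toFun =ᵐ[μG] waveletFun A v :=
  AEEqFun.coeFn_mk _ _

theorem norm_sq_waveletOp {A : gardingDomain μG π →ₗ[ℂ] K} (hA : IsAdmissible σ θ A)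
    (v : gardingDomain μG π) :
    ‖waveletOp hA v‖ ^ 2 = ∫ g, ‖waveletFun A v g‖ ^ 2 * θ.toFun g ∂μG := by
  rw [InducedSpace.norm_sq_eq]
  refine integral_congr_ae ?_
  filter_upwards [waveletOp_toFun hA v] with g hg
  rw [hg]

theorem waveletOp_gardingMap {A : gardingDomain μG π →ₗ[ℂ] K} (hA : IsAdmissible σ θ A) (g : G)
    (v : gardingDomain μG π) :
    waveletOp hA (gardingMap μG π g v) = inducedRep μG σ θ g (waveletOp hA v) := by
  refine InducedSpace.ext ?_
  filter_upwards [waveletOp_toFun hA (gardingMap μG π g v), translate_toFun g (waveletOp hA v),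
    (measurePreserving_mul_left μG g⁻¹).quasiMeasurePreserving.ae (waveletOp_toFun hA v)]
    with x h1 h2 h3
  rw [h1]
  refine Eq.trans ?_ (h3.symm.trans h2.symm)
  simp [waveletFun, gardingMap_gardingMap]

/-- The wavelet operator of an admissible map that is bounded below extends to an intertwining
operator that is bounded below. -/
theorem IsAdmissible.isEquivSubrepresentation [CompleteSpace K]
    (hπ : ∀ v : E, Continuous fun g => π g v)
    {A : gardingDomain μG π →ₗ[ℂ] K} (hA : IsAdmissible σ θ A) {α : ℝ} (hα : 0 < α)
    (hb : ∀ v : gardingDomain μG π,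
      α * ‖(v : E)‖ ^ 2 ≤ ∫ g, ‖waveletFun A v g‖ ^ 2 * θ.toFun g ∂μG) :
    IsEquivSubrepresentation π (inducedRep μG σ θ) := by
  obtain ⟨β, hβ, hA2⟩ := hA.square_integrable
  have hdense : DenseRange (gardingDomain μG π).subtype := by
    simpa [DenseRange] using dense_gardingDomain μG hπ
  have hbound : ∃ C, ∀ v, ‖waveletOp hA v‖ ≤ C * ‖(gardingDomain μG π).subtype v‖ := by
    refine ⟨Real.sqrt β, fun v => ?_⟩
    refine (sq_le_sq₀ (norm_nonneg _) (by positivity)).1 ?_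
    rw [mul_pow, Real.sq_sqrt hβ.le, norm_sq_waveletOp]
    exact (hA2 v).2
  set W := (waveletOp hA).extendOfNorm (gardingDomain μG π).subtype
  have hW : ∀ v : gardingDomain μG π, W v = waveletOp hA v :=
    LinearMap.extendOfNorm_eq hdense hbound
  refine isEquivSubrepresentation_of_bounded_below W (fun g v => ?_) hα fun v => ?_
  · refine hdense.induction_on (p := fun v => W (π g v) = inducedRep μG σ θ g (W v)) v
      (isClosed_eq (W.continuous.comp (π g).continuous)
        ((inducedRep μG σ θ g).continuous.comp W.continuous)) fun v => ?_
    simp only [Submodule.subtype_apply]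
    rw [hW, ← waveletOp_gardingMap, ← hW]
    rfl
  · refine hdense.induction_on (p := fun v => α * ‖v‖ ^ 2 ≤ ‖W v‖ ^ 2) v
      (isClosed_le (by fun_prop) (by fun_prop)) fun v => ?_
    simp only [Submodule.subtype_apply]
    rw [hW, norm_sq_waveletOp]
    exact hb v

/-- An intertwining operator maps the Gårding domain to continuous elements. -/
theorem apply_mem_continuousElements [CompleteSpace K] (hπ : ∀ v : E, Continuous fun g => π g v)
    (T : E →L[ℂ] InducedSpace μG σ θ) (hT : ∀ g v, T (π g v) = inducedRep μG σ θ g (T v))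
    {v : E} (hv : v ∈ gardingDomain μG π) : T v ∈ continuousElements μG σ θ := by
  suffices h : gardingDomain μG π ≤ (continuousElements μG σ θ).comap T.toLinearMap from h hv
  refine Submodule.span_le.2 ?_
  rintro _ ⟨f, u, rfl⟩
  have hi := integrable_smul_apply μG hπ f u
  have hTi : Integrable (fun g => f g • inducedRep μG σ θ g (T u)) μG := by
    simpa only [map_smul, hT] using T.integrable_comp hi
  refine ⟨_, continuous_smoothing f (T u).aestronglyMeasurable fun C hC => (T u).integrableOn hC, ?_⟩
  have h1 : T (integratedRep μG π f u) = ∫ g, f g • inducedRep μG σ θ g (T u) ∂μG := by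
    rw [integratedRep, ← T.integral_comp_comm hi]
    simp only [map_smul, hT]
  change (T (integratedRep μG π f u)).toFun =ᵐ[μG] _
  rw [h1]
  exact integral_smul_inducedRep_toFun f (T u) hTi

/-- If `T` is an isometric intertwining operator, evaluating the continuous representative of `T v`
at `1` defines an admissible map, whose wavelet operator is `T`. -/
theorem exists_isAdmissible [CompleteSpace K] (hπ : ∀ v : E, Continuous fun g => π g v)
    (T : E →L[ℂ] InducedSpace μG σ θ) (hT : ∀ g v, T (π g v) = inducedRep μG σ θ g (T v))
    (hiso : ∀ v, ‖T v‖ = ‖v‖) :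
    ∃ A : gardingDomain μG π →ₗ[ℂ] K, IsAdmissible σ θ A ∧ ∀ v : gardingDomain μG π,
      ∫ g, ‖waveletFun A v g‖ ^ 2 * θ.toFun g ∂μG = ‖(v : E)‖ ^ 2 := by
  set T₀ : gardingDomain μG π →ₗ[ℂ] continuousElements μG σ θ :=
    T.toLinearMap.restrict fun v hv => apply_mem_continuousElements hπ T hT hv with hT₀
  set A := evalOne μG σ θ ∘ₗ T₀ with hA
  have hgard : ∀ g v, A (gardingMap μG π g v) = contRep (T₀ v) g⁻¹ := fun g v => by
    rw [← mul_one g⁻¹]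
    exact contRep_inducedRep (hT g v) 1
  have hwav : ∀ v, waveletFun A v = contRep (T₀ v) := fun v => funext fun g => by
    rw [waveletFun, hgard, inv_inv]
  have hnorm : ∀ v : gardingDomain μG π,
      ∫ g, ‖waveletFun A v g‖ ^ 2 * θ.toFun g ∂μG = ‖(v : E)‖ ^ 2 := fun v => by
    rw [← hiso, InducedSpace.norm_sq_eq, hwav]
    refine integral_congr_ae ?_
    filter_upwards [toFun_ae_eq_contRep (T₀ v)] with g hg
    rw [← hg]
    rfl
  refine ⟨A, ⟨fun h v => ?_, fun v => ?_, 1, one_pos, fun v => ⟨?_, ?_⟩⟩, hnorm⟩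
  · have h1 := contRep_mul (T₀ v) (h : G)⁻¹ h
    rw [inv_mul_cancel] at h1
    rw [hgard]
    change σ h (contRep (T₀ v) 1) = _
    rw [h1, map_smul, map_inv]
    exact congrArg _ ((σ h).apply_symm_apply _)
  · rw [hwav]
    exact (continuous_contRep _).aestronglyMeasurable
  · rw [hwav, ← memLp_weight_iff (continuous_contRep _).aestronglyMeasurable]
    exact (memLp_congr_ae ((weight_ac θ μG).ae_eq (toFun_ae_eq_contRep (T₀ v)))).1 (T v).memLp
  · rw [hnorm, one_mul]

end Wavelet

end SqInt

theorem mainTheorem3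
    {G : Type*} [Group G] [TopologicalSpace G] [IsTopologicalGroup G] [LocallyCompactSpace G]
    [SecondCountableTopology G] [T2Space G] [MeasurableSpace G] [BorelSpace G]
    (H : Subgroup G) [IsClosed (H : Set G)]
    (μG : Measure G) [IsHaarMeasure μG] (μH : Measure H) [IsHaarMeasure μH]
    (θ : SqInt.WeightFunction H μH)
    {K : Type*} [NormedAddCommGroup K] [InnerProductSpace ℂ K] [CompleteSpace K]
    [TopologicalSpace.SeparableSpace K]
    (σ : H →* (K ≃ₗᵢ[ℂ] K)) (hσ : ∀ w : K, Continuous fun h => σ h w)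
    {E : Type*} [NormedAddCommGroup E] [InnerProductSpace ℂ E] [CompleteSpace E]
    [TopologicalSpace.SeparableSpace E]
    (π : G →* (E ≃ₗᵢ[ℂ] E)) (hπ : ∀ v : E, Continuous fun g => π g v) :
    List.TFAE [
      SqInt.IsEquivSubrepresentation π (SqInt.inducedRep μG σ θ),
      ∃ A : SqInt.gardingDomain μG π →ₗ[ℂ] K, SqInt.IsAdmissible σ θ A ∧
        ∀ v : SqInt.gardingDomain μG π,
          ∫ g, ‖SqInt.waveletFun A v g‖ ^ 2 * θ.toFun g ∂μG = ‖(v : E)‖ ^ 2,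
      ∃ A : SqInt.gardingDomain μG π →ₗ[ℂ] K, SqInt.IsAdmissible σ θ A ∧
        ∃ α β : ℝ, 0 < α ∧ α ≤ β ∧ ∀ v : SqInt.gardingDomain μG π,
          α * ‖(v : E)‖ ^ 2 ≤ ∫ g, ‖SqInt.waveletFun A v g‖ ^ 2 * θ.toFun g ∂μG ∧
          ∫ g, ‖SqInt.waveletFun A v g‖ ^ 2 * θ.toFun g ∂μG ≤ β * ‖(v : E)‖ ^ 2] := by
  tfae_have 1 → 2 := by
    rintro ⟨M, -, -, T, hT⟩
    exact SqInt.exists_isAdmissible hπ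
      (M.subtypeₗᵢ.comp T.toLinearIsometry).toContinuousLinearMap hT
      (M.subtypeₗᵢ.comp T.toLinearIsometry).norm_map
  tfae_have 2 → 3 := by
    rintro ⟨A, hA, h⟩
    exact ⟨A, hA, 1, 1, one_pos, le_rfl, fun v => by simp [h]⟩
  tfae_have 3 → 1 := by
    rintro ⟨A, hA, α, β, hα, -, h⟩
    exact hA.isEquivSubrepresentation hπ hα fun v => (h v).1
  tfae_finish
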